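/- Let $k$ be a field and let $\mathscr{P}^\heartsuit$ be a $k$-linear highest weight category with respect to a finite partially ordered set $\mathscr{W}$. Precisely: $\mathscr{P}^\heartsuit$ is a $k$-linear abelian category with enough projectives and injectives, in which every object has finite length; its simple objects up to isomorphism are $L_w$, $w\in\mathscr{W}$ (pairwise non-isomorphic), and $\operatorname{End}(L_w)=k$. For $w\in\mathscr{W}$ let $\mathscr{P}^\heartsuit_{\leqslant w}$ be the full subcategory of objects all of whose composition factors are of the form $L_y$ with $y\leqslant w$, and let $M_w\to L_w$ and $L_w\to A_w$ be a projective cover and an injective envelope of $L_w$ in $\mathscr{P}^\heartsuit_{\leqslant w}$ (the standard and costandard objects). It is required that (1) $\operatorname{End}(M_w)=k$ for all $w$; (2) if $\operatorname{Hom}(M_y,M_w)\neq 0$ then $y\leqslant w$; (3) if $P_w$ denotes a projective cover of $L_w$ in $\mathscr{P}^\heartsuit$, the kernel of the canonical surjection $P_w\to M_w$ has a finite filtration with successive quotients of the form $M_x$ with $x>w$. Let $\mathscr{P}$ be the bounded derived category of $\mathscr{P}^\heartsuit$, and write $\operatorname{Ext}^n(N,A_w)=\operatorname{Hom}_{\mathscr{P}}(N,A_w[n])$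 for $N\in\mathscr{P}$ and $n\in\mathbb{Z}$. Let $\ell:\mathscr{W}\to\mathbb{Z}$, $w\mapsto \ell_w$, be a function such that $\ell_y<\ell_w$ whenever $y<w$. Call an object $N$ of $\mathscr{P}$ coconnective if $\operatorname{Ext}^n(N,A_w)=0$ for all $w\in\mathscr{W}$ and all $n>-\ell_w$, and call an object $M$ connective if $\operatorname{Hom}_{\mathscr{P}}(M,N)=0$ for every coconnective $N$. Then there is a $t$-structure $(\mathscr{P}^{\leqslant 0},\mathscr{P}^{\geqslant 0})$ on $\mathscr{P}$ such that $\mathscr{P}^{\geqslant 0}$ is the full subcategory of coconnective objects (the constructible $t$-structure). For any such $t$-structure, $\mathscr{P}^{<0}=\mathscr{P}^{\leqslant 0}[1]$ is the full subcategory of connective objects; an object $M$ of $\mathscr{P}$ is connective if and only if $\operatorname{Ext}^n(M,A_w)=0$ for all $w\in\mathscr{W}$ and all $n\leqslant-\ell_w$; and $M$ lies in the heart $\mathscr{P}^{\leqslant 0}\cap\mathscr{P}^{\geqslant 0}$ if and only if $\operatorname{Ext}^n(M,A_w)=0$ for all $w\in\mathscr{W}$ and all $n\neq-\ell_w$. 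-/

import Mathlib

open CategoryTheory CategoryTheory.Limits CategoryTheory.Triangulated

universe w v u

namespace HighestWeight

section Abelian

variable {C : Type u} [Category.{v} C]

/-- `S` is a subquotient of `X`: a quotient of a subobject of `X`. -/
def IsSubquotient (S X : C) : Prop :=
  ∃ (T : C) (i : T ⟶ X) (q : T ⟶ S), Mono i ∧ Epi q

/-- Given a family `L` of simple objects indexed by `W` and a subset `Z` of `W`, the thick (Serre)
subcategory attached to `Z`: its objects are those all of whose composition factors
among the `L y` have `y ∈ Z`. -/
def supportedOn {W : Type*} (L : W → C) (Z : Set W) : ObjectProperty C :=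
  fun X => ∀ y : W, IsSubquotient (L y) X → y ∈ Z

/-- `π : M ⟶ S` is a projective cover of `S` in the full subcategory `P` of `C`
(which is applied to thick subcategories only, so that epimorphisms in `P` are
the epimorphisms of `C` between objects of `P`). -/
structure IsProjectiveCoverIn (P : ObjectProperty C) {M S : C} (π : M ⟶ S) : Prop where
  mem : P M
  /-- `M` is a projective object of `P` -/
  lifting : ∀ ⦃X Y : C⦄, P X → P Y → ∀ (f : M ⟶ Y) (e : X ⟶ Y), Epi e → ∃ g : M ⟶ X, g ≫ e = f
  epi : Epi π
  /-- `π` is an essential epimorphism -/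
  essential : ∀ ⦃X : C⦄ (g : X ⟶ M), Epi (g ≫ π) → Epi g

/-- `ι : S ⟶ A` is an injective envelope of `S` in the full subcategory `P` of `C`
(again applied to thick subcategories only). -/
structure IsInjectiveEnvelopeIn (P : ObjectProperty C) {S A : C} (ι : S ⟶ A) : Prop where
  mem : P A
  /-- `A` is an injective object of `P` -/
  extension : ∀ ⦃X Y : C⦄, P X → P Y → ∀ (f : X ⟶ A) (m : X ⟶ Y), Mono m → ∃ g : Y ⟶ A, m ≫ g = f
  mono : Mono ι
  /-- `ι` is an essential monomorphism -/
  essential : ∀ ⦃X : C⦄ (g : A ⟶ X), Mono (ι ≫ g) → Mono g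

/-- `IsFiltered M Z X`: the object `X` has a finite filtration whose successive quotients are
of the form `M x` with `x ∈ Z`. -/
inductive IsFiltered [Preadditive C] {W : Type*} (M : W → C) (Z : Set W) : C → Prop
  | zero (X : C) (hX : IsZero X) : IsFiltered M Z X
  | step (X' X : C) (x : W) (i : X' ⟶ X) (p : X ⟶ M x) (hip : i ≫ p = 0)
      (hx : x ∈ Z) (h : (ShortComplex.mk i p hip).ShortExact) (hX' : IsFiltered M Z X') :
      IsFiltered M Z X

end Abelian

/-- The structure of a `k`-linear highest weight category on the abelian category `C`, with
respect to the partially ordered set `W`. -/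
structure HighestWeightCategory (k : Type*) [Field k] (C : Type u) [Category.{v} C] [Abelian C]
    [Linear k C] (W : Type*) [PartialOrder W] where
  enoughProjectives : EnoughProjectives C
  enoughInjectives : EnoughInjectives C
  /-- every object has finite length, i.e. is both noetherian and artinian -/
  noetherian : ∀ X : C, IsNoetherianObject X
  artinian : ∀ X : C, IsArtinianObject X
  /-- the simple objects -/
  L : W → C
  simple : ∀ y, Simple (L y)
  eq_of_iso : ∀ y z, Nonempty (L y ≅ L z) → y = z
  exists_iso : ∀ S : C, Simple S → ∃ y, Nonempty (S ≅ L y)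
  /-- endomorphisms of simple objects are scalars -/
  end_simple : ∀ y, Function.Bijective (fun c : k => c • 𝟙 (L y))
  /-- the standard objects, with their projections onto the simple objects -/
  M : W → C
  π : ∀ y, M y ⟶ L y
  isProjectiveCover : ∀ y, IsProjectiveCoverIn (supportedOn L (Set.Iic y)) (π y)
  /-- the costandard objects, with the inclusions of the simple objects -/
  A : W → C
  ι : ∀ y, L y ⟶ A y
  isInjectiveEnvelope : ∀ y, IsInjectiveEnvelopeIn (supportedOn L (Set.Iic y)) (ι y)
  end_standard : ∀ y, Function.Bijective (fun c : k => c • 𝟙 (M y))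
  le_of_hom_ne_zero : ∀ y z (f : M y ⟶ M z), f ≠ 0 → y ≤ z
  /-- the kernel of the canonical surjection `p` of the projective cover `P` of `L y` (in `C`)
  onto `M y` is filtered by standard objects `M x` with `x > y` -/
  exists_filtration : ∀ y, ∃ (P : C) (q : P ⟶ L y) (p : P ⟶ M y),
    IsProjectiveCoverIn ⊤ q ∧ p ≫ π y = q ∧ IsFiltered M (Set.Ioi y) (kernel p)

section Derived

variable {C : Type u} [Category.{v} C] [Abelian C] [HasDerivedCategory.{w} C]

/-- An object of `C`, seen as an object of the bounded derived category
concentrated in cohomological degree `0`. -/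
noncomputable def single (X : C) : DerivedCategory.Bounded C :=
  ⟨(DerivedCategory.singleFunctor C 0).obj X, ⟨⟨0, inferInstance⟩, ⟨0, inferInstance⟩⟩⟩

/-- `Ext^n(N, X)`, for `N` in the bounded derived category of `C`, `X` in `C`
and an integer `n`. -/
abbrev Ext (N : DerivedCategory.Bounded C) (X : C) (n : ℤ) : Type w :=
  N ⟶ (shiftFunctor (DerivedCategory.Bounded C) n).obj (single X)

/-- The coconnective objects: those `N` with `Ext^n(N, A y) = 0` for all `y` and `n > -ℓ y`. -/
def IsCoconnective {k : Type*} [Field k] [Linear k C] {W : Type*} [PartialOrder W]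
    (H : HighestWeightCategory k C W) (ℓ : W → ℤ) :
    ObjectProperty (DerivedCategory.Bounded C) :=
  fun N => ∀ (y : W) (n : ℤ), -ℓ y < n → ∀ f : Ext N (H.A y) n, f = 0

/-- The connective objects: those `M` with `Hom(M, N) = 0` for every coconnective `N`. -/
def IsConnective {k : Type*} [Field k] [Linear k C] {W : Type*} [PartialOrder W]
    (H : HighestWeightCategory k C W) (ℓ : W → ℤ) :
    ObjectProperty (DerivedCategory.Bounded C) :=
  fun M => ∀ N, IsCoconnective H ℓ N → ∀ f : M ⟶ N, f = 0

end Derived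

end HighestWeight

/-! Put `Δ y = M y[-ℓ y]` and `N y = A y[-ℓ y]`. The condition on `Hom(M y, M z)` and dimension
shifting along the projective presentations give `Ext^n(M x, M y) = 0` for all `n` unless `x ≤ y`.
As `ℓ` is strictly increasing, the `Δ y` then have no negative extensions among each other and the
degree 0 maps are zero or invertible; they also generate, so they are simple-minded
(`isSimpleMinded`).

For such a family, a negative shift `Y` of a `Δ y` followed by a nonnegative shift `Z` of a `Δ z`
can be exchanged: the connecting map `Z ⟶ Y[1]` is zero, and the extension splits, or invertible,
and the extension vanishes (`extensionProduct_le`). Sorting iterated extensions in this way gives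
the truncation triangles (`IsSimpleMinded.truncatable`).

Since `Ext^n(M x, A y) = 0` unless `x = y` and `n = 0`, and the `A y` cogenerate, the `N y` form a
dual family (`isDualFamily`). Maps into their shifts detect both halves of a truncation triangle,
hence the aisle, the coaisle and the heart. Any other t-structure with this coaisle has the same
aisle, by orthogonality. -/

namespace HighestWeight

/-! ### Simple-minded families and their t-structures -/

section SimpleMinded

open Pretriangulated ObjectProperty

section Shift

variable {D : Type*} [Category* D] [HasShift D ℤ] [Preadditive D]

variable {W : Type*}

/-- The zero objects and the shifts of the objects `Δ y` by integers in `Z`. -/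
def shiftsOf (Δ : W → D) (Z : Set ℤ) : ObjectProperty D :=
  fun X => IsZero X ∨ ∃ y, ∃ n ∈ Z, Nonempty (X ≅ (Δ y)⟦n⟧)

instance (Δ : W → D) (Z : Set ℤ) : (shiftsOf Δ Z).IsClosedUnderIsomorphisms where
  of_iso := by
    rintro X Y e (h | ⟨y, n, hn, ⟨e'⟩⟩)
    · exact Or.inl (h.of_iso e.symm)
    · exact Or.inr ⟨y, n, hn, ⟨e.symm ≪≫ e'⟩⟩

lemma shiftsOf_leftOrthogonal_iff {Δ : W → D} {Z : Set ℤ} {X : D} :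
    (shiftsOf Δ Z).leftOrthogonal X ↔ ∀ y, ∀ n ∈ Z, ∀ f : X ⟶ (Δ y)⟦n⟧, f = 0 := by
  refine ⟨fun h y n hn f => h f (Or.inr ⟨y, n, hn, ⟨Iso.refl _⟩⟩), fun h Y f hY => ?_⟩
  obtain hY | ⟨y, n, hn, ⟨e⟩⟩ := hY
  · exact hY.eq_of_tgt _ _
  · rw [← cancel_mono e.hom, h y n hn (f ≫ e.hom), zero_comp]

/-- A family `N` which is dual to `Δ`, and which cogenerates. -/
structure IsDualFamily (Δ N : W → D) : Prop where
  hom_eq_zero : ∀ x y (n : ℤ), n ≠ 0 → ∀ f : Δ x ⟶ (N y)⟦n⟧, f = 0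
  isZero : ∀ X, (∀ y (n : ℤ), ∀ f : X ⟶ (N y)⟦n⟧, f = 0) → IsZero X

lemma IsDualFamily.isZero_of_leftOrthogonal {Δ N : W → D} (hN : IsDualFamily Δ N) {X : D}
    (h₁ : (shiftsOf N (Set.Iio 0)).leftOrthogonal X)
    (h₂ : (shiftsOf N (Set.Ici 0)).leftOrthogonal X) : IsZero X :=
  hN.isZero X fun y n => by
    obtain hn | hn := lt_or_ge n 0
    · exact shiftsOf_leftOrthogonal_iff.1 h₁ y n hn
    · exact shiftsOf_leftOrthogonal_iff.1 h₂ y n hn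

variable [∀ n : ℤ, (shiftFunctor D n).Additive]

/-- All morphisms `X⟦a⟧ ⟶ Y⟦b⟧` vanish if all morphisms `X ⟶ Y⟦b - a⟧` do. -/
lemma eq_zero_of_shift {X Y : D} {a b c : ℤ} (h : a + c = b)
    (hXY : ∀ f : X ⟶ Y⟦c⟧, f = 0) (f : X⟦a⟧ ⟶ Y⟦b⟧) : f = 0 := by
  let e := (shiftFunctorAdd' D c a b (by lia)).app Y
  obtain ⟨g, hg⟩ := (shiftFunctor D a).map_surjective (f ≫ e.hom)
  rw [hXY g, Functor.map_zero] at hg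
  rw [← cancel_mono e.hom, ← hg, zero_comp]

lemma eq_zero_of_unshift {X Y : D} {a b c : ℤ} (h : a + c = b)
    (hXY : ∀ f : X⟦a⟧ ⟶ Y⟦b⟧, f = 0) (f : X ⟶ Y⟦c⟧) : f = 0 := by
  let e := (shiftFunctorAdd' D c a b (by lia)).app Y
  apply (shiftFunctor D a).map_injective
  rw [← cancel_mono e.inv, hXY (_ ≫ e.inv), Functor.map_zero, zero_comp]

lemma shiftsOf_leftOrthogonal_shift_iff {Δ : W → D} {Z Z' : Set ℤ} {X : D} (a : ℤ)
    (h : ∀ n, n ∈ Z ↔ a + n ∈ Z') :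
    (shiftsOf Δ Z').leftOrthogonal (X⟦a⟧) ↔ (shiftsOf Δ Z).leftOrthogonal X := by
  rw [shiftsOf_leftOrthogonal_iff, shiftsOf_leftOrthogonal_iff]
  refine ⟨fun H y n hn => eq_zero_of_unshift rfl (H y (a + n) ((h n).1 hn)), fun H y n hn =>
    eq_zero_of_shift (c := n - a) (by lia) (H y (n - a) ((h _).2 (by simpa using hn)))⟩

lemma shiftsOf_le_leftOrthogonal {Δ N : W → D} {Z Z' : Set ℤ}
    (h : ∀ x y (n : ℤ), n ≠ 0 → ∀ f : Δ x ⟶ (N y)⟦n⟧, f = 0) (hZ : Disjoint Z Z') :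
    shiftsOf Δ Z ≤ (shiftsOf N Z').leftOrthogonal := by
  rintro X (hX | ⟨y, n, hn, ⟨e⟩⟩)
  · exact fun _ _ _ => hX.eq_of_src _ _
  · refine (prop_iff_of_iso _ e).2 (shiftsOf_leftOrthogonal_iff.2 fun z m hm =>
      eq_zero_of_shift (c := m - n) (by lia) (h y z _ fun h0 => ?_))
    obtain rfl : m = n := by lia
    exact hZ.ne_of_mem hn hm rfl

end Shift

variable {D : Type*} [Category* D] [HasZeroObject D] [HasShift D ℤ] [Preadditive D]
  [∀ n : ℤ, (shiftFunctor D n).Additive] [Pretriangulated D] {W : Type*}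

/-- A family of objects `Δ` of a triangulated category is simple-minded if it generates the
category, has no negative self-extensions, and if morphisms between its members
are zero or invertible. -/
structure IsSimpleMinded (Δ : W → D) : Prop where
  hom_neg : ∀ x y (n : ℤ), n < 0 → ∀ f : Δ x ⟶ (Δ y)⟦n⟧, f = 0
  hom_zero : ∀ x y (f : Δ x ⟶ Δ y), f = 0 ∨ IsIso f
  generates : ∀ T : ObjectProperty D, T.IsTriangulated → T.IsClosedUnderIsomorphisms →
    (∀ y, T (Δ y)) → ∀ X, T X

/-- Zero objects are admitted so that each factor of an extension product is contained in the
product. -/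
instance (Δ : W → D) (Z : Set ℤ) : (shiftsOf Δ Z).ContainsZero :=
  ⟨_, isZero_zero D, Or.inl (isZero_zero D)⟩

lemma extensionProduct_of_zero {P Q : ObjectProperty D} (T : Triangle D) (hT : T ∈ distTriang D)
    (h₀ : T.mor₃ = 0) (h₁ : P T.obj₁) (h₃ : Q T.obj₃) : extensionProduct Q P T.obj₂ := by
  obtain ⟨e, -⟩ := exists_iso_binaryBiproduct_of_distTriang T hT h₀
  exact (prop_iff_of_iso _ (e ≪≫ biprod.braiding _ _)).2
    ⟨_, _, _, _, _, binaryBiproductTriangle_distinguished T.obj₃ T.obj₁, h₃, h₁⟩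

lemma IsSimpleMinded.zero_or_isIso {Δ : W → D} (hΔ : IsSimpleMinded Δ) (x y : W) {a b : ℤ}
    (hab : b ≤ a) (f : (Δ x)⟦a⟧ ⟶ (Δ y)⟦b⟧) : f = 0 ∨ IsIso f := by
  obtain hab | rfl := hab.lt_or_eq
  · exact Or.inl (eq_zero_of_shift (c := b - a) (by lia) (hΔ.hom_neg x y _ (by lia)) f)
  · obtain ⟨g, rfl⟩ := (shiftFunctor D b).map_surjective f
    obtain rfl | hg := hΔ.hom_zero x y g
    · exact Or.inl (Functor.map_zero _ _ _)
    · exact Or.inr inferInstance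

/-- The connecting map goes from a shift by `n ≥ 0` to a shift by `m + 1 ≤ 0`, so it is zero or
invertible: the middle term is a direct sum, whose summands may be swapped, or it is zero. -/
lemma IsSimpleMinded.extensionProduct_le {Δ : W → D} (hΔ : IsSimpleMinded Δ) :
    extensionProduct (shiftsOf Δ (Set.Iio 0)) (shiftsOf Δ (Set.Ici 0)) ≤
      extensionProduct (shiftsOf Δ (Set.Ici 0)) (shiftsOf Δ (Set.Iio 0)) := by
  rintro E ⟨Y, Z, f, g, h, hT, hY, hZ⟩
  suffices h = 0 ∨ IsIso h by
    obtain h0 | h0 := this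
    · exact extensionProduct_of_zero _ hT h0 hY hZ
    · exact le_extensionProduct_left _ _ (Or.inl (Triangle.isZero₂_of_isIso₃ _ hT h0))
  obtain hY | ⟨y, m, hm, ⟨eY⟩⟩ := hY
  · exact Or.inl (((shiftFunctor D (1 : ℤ)).map_isZero hY).eq_of_tgt _ _)
  obtain hZ | ⟨z, n, hn, ⟨eZ⟩⟩ := hZ
  · exact Or.inl (hZ.eq_of_src _ _)
  let e : Y⟦(1 : ℤ)⟧ ≅ (Δ y)⟦m + 1⟧ :=
    (shiftFunctor D (1 : ℤ)).mapIso eY ≪≫ (shiftFunctorAdd' D m 1 (m + 1) rfl).symm.app _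
  have hm' : m < 0 := hm
  have hn' : 0 ≤ n := hn
  have := hΔ.zero_or_isIso z y (a := n) (b := m + 1) (by lia) (eZ.inv ≫ h ≫ e.hom)
  simpa using this

lemma extensionProduct_iter_le [IsTriangulated D] {A B : ObjectProperty D}
    (h : extensionProduct A B ≤ extensionProduct B A) (n : ℕ) :
    extensionProduct A (B.extensionProductIter n) ≤
      extensionProduct (B.extensionProductIter n) A := by
  induction n with
  | zero => exact h
  | succ n hn =>
    rw [extensionProductIter_succ, ← extensionProduct_assoc]
    refine (monotone_extensionProduct_left _ h).trans ?_
    rw [extensionProduct_assoc, extensionProduct_assoc]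
    exact monotone_extensionProduct_right _ hn

lemma iter_extensionProduct_iter_le [IsTriangulated D] {A B : ObjectProperty D}
    (h : extensionProduct A B ≤ extensionProduct B A) (m n : ℕ) :
    extensionProduct (A.extensionProductIter m) (B.extensionProductIter n) ≤
      extensionProduct (B.extensionProductIter n) (A.extensionProductIter m) := by
  induction m with
  | zero => exact extensionProduct_iter_le h n
  | succ m hm =>
    rw [extensionProductIter_succ, extensionProduct_assoc]
    refine (monotone_extensionProduct_right _ hm).trans ?_
    rw [← extensionProduct_assoc, ← extensionProduct_assoc]
    exact monotone_extensionProduct_left _ (extensionProduct_iter_le h n)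

/-- The extension products of iterated extensions of objects in `B` by iterated extensions of
objects in `A`. -/
def truncatable (A B : ObjectProperty D) : ObjectProperty D :=
  fun X => ∃ m n, extensionProduct (B.extensionProductIter n) (A.extensionProductIter m) X

instance (A B : ObjectProperty D) : (truncatable A B).IsClosedUnderIsomorphisms where
  of_iso := by
    rintro X Y e ⟨m, n, h⟩
    exact ⟨m, n, prop_of_iso _ e h⟩

lemma truncatable_ext [IsTriangulated D] {A B : ObjectProperty D}
    (h : extensionProduct A B ≤ extensionProduct B A) (T : Triangle D) (hT : T ∈ distTriang D)
    (h₁ : truncatable A B T.obj₁) (h₃ : truncatable A B T.obj₃) : truncatable A B T.obj₂ := by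
  obtain ⟨m, n, h₁⟩ := h₁
  obtain ⟨m', n', h₃⟩ := h₃
  -- `extensionProductIter n` has `n + 1` factors, hence the extra `1`. The four blocks are sorted
  -- by exchanging the middle two.
  refine ⟨m + 1 + m', n + 1 + n', ?_⟩
  rw [extensionProductIter_add _ (n' := m) rfl, extensionProductIter_add _ (n' := n) rfl,
    extensionProduct_assoc, ← extensionProduct_assoc (B.extensionProductIter n')]
  refine monotone_extensionProduct_right _ (monotone_extensionProduct_left _
    (iter_extensionProduct_iter_le h m n')) _ ?_
  rw [extensionProduct_assoc, ← extensionProduct_assoc]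
  exact ⟨_, _, _, _, _, hT, h₁, h₃⟩

lemma IsSimpleMinded.truncatable [IsTriangulated D] {Δ : W → D} (hΔ : IsSimpleMinded Δ) (X : D) :
    truncatable (shiftsOf Δ (Set.Iio 0)) (shiftsOf Δ (Set.Ici 0)) X := by
  set S := HighestWeight.truncatable (shiftsOf Δ (Set.Iio 0)) (shiftsOf Δ (Set.Ici 0))
  -- `S` is not visibly stable under shifts; requiring it of all shifts yields a triangulated
  -- subcategory.
  let T : ObjectProperty D := fun X => ∀ a : ℤ, S (X⟦a⟧)
  have hT₀ (y : W) : T (Δ y) := fun a => by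
    obtain ha | ha := le_or_gt 0 a
    · exact ⟨0, 0, le_extensionProduct_left (Q := shiftsOf Δ _) _ (Or.inr ⟨y, a, ha, ⟨Iso.refl _⟩⟩)⟩
    · exact ⟨0, 0, le_extensionProduct_right (P := shiftsOf Δ _) _ (Or.inr ⟨y, a, ha, ⟨Iso.refl _⟩⟩)⟩
  have hT₁ : T.IsClosedUnderIsomorphisms :=
    ⟨fun e h a => S.prop_of_iso ((shiftFunctor D a).mapIso e) (h a)⟩
  have hT₂ : T.IsTriangulated :=
    { exists_zero := ⟨_, isZero_zero D, fun a => ⟨0, 0, le_extensionProduct_left (Q := shiftsOf Δ _) _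
        (Or.inl ((shiftFunctor D a).map_isZero (isZero_zero D)))⟩⟩
      isStableUnderShiftBy := fun a => ⟨fun X hX b =>
        S.prop_of_iso ((shiftFunctorAdd' D a b _ rfl).app X) (hX _)⟩
      toIsTriangulatedClosed₂ := .mk' fun T' hT' h₁ h₃ a =>
        truncatable_ext hΔ.extensionProduct_le _ (Triangle.shift_distinguished T' hT' a)
          (h₁ a) (h₃ a) }
  exact S.prop_of_iso ((shiftFunctorZero D ℤ).app X) (hΔ.generates T hT₂ hT₁ hT₀ X 0)

variable {Δ N : W → D}

lemma iter_isClosedUnderIsomorphisms (P : ObjectProperty D) [P.IsClosedUnderIsomorphisms] (n : ℕ) :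
    (P.extensionProductIter n).IsClosedUnderIsomorphisms := by
  cases n with
  | zero => simpa
  | succ n => rw [extensionProductIter_succ]; infer_instance

/-- The two halves of the truncation triangle, in terms of the dual family. -/
lemma IsSimpleMinded.exists_triangle [IsTriangulated D] (hΔ : IsSimpleMinded Δ)
    (hN : IsDualFamily Δ N) (E : D) : ∃ (m n : ℕ) (X Y : D)
      (_ : (shiftsOf Δ (Set.Ici 0)).extensionProductIter n X)
      (_ : (shiftsOf Δ (Set.Iio 0)).extensionProductIter m Y)
      (_ : (shiftsOf N (Set.Iio 0)).leftOrthogonal X)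
      (_ : (shiftsOf N (Set.Ici 0)).leftOrthogonal Y) (f : X ⟶ E) (g : E ⟶ Y) (h : Y ⟶ X⟦(1 : ℤ)⟧),
      Triangle.mk f g h ∈ distTriang D := by
  obtain ⟨m, n, X, Y, f, g, h, hT, hX, hY⟩ := hΔ.truncatable E
  refine ⟨m, n, X, Y, hX, hY, ?_, ?_, f, g, h, hT⟩
  · exact extensionProductIter_le_of_isTriangulatedClosed₂ _
      (shiftsOf_le_leftOrthogonal hN.hom_eq_zero
        (Set.disjoint_left.2 fun a (h : 0 ≤ a) h' => not_lt_of_ge h h')) n X hX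
  · exact extensionProductIter_le_of_isTriangulatedClosed₂ _
      (shiftsOf_le_leftOrthogonal hN.hom_eq_zero
        (Set.disjoint_left.2 fun a (h : a < 0) h' => not_lt_of_ge h' h)) m Y hY

/-- The negative part `Y` of `E` is an extension of `X[1]` by `E`, so it has no maps to negative
shifts of `N` either, and vanishes. -/
lemma IsSimpleMinded.exists_iter_of_Iio [IsTriangulated D] (hΔ : IsSimpleMinded Δ)
    (hN : IsDualFamily Δ N) {E : D} (hE : (shiftsOf N (Set.Iio 0)).leftOrthogonal E) :
    ∃ n, (shiftsOf Δ (Set.Ici 0)).extensionProductIter n E := by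
  obtain ⟨m, n, X, Y, hX, hY, hX', hY', f, g, h, hT⟩ := hΔ.exists_triangle hN E
  have := iter_isClosedUnderIsomorphisms (shiftsOf Δ (Set.Ici 0)) n
  have hY₀ : IsZero Y := hN.isZero_of_leftOrthogonal (ext_of_isTriangulatedClosed₂
    (shiftsOf N (Set.Iio 0)).leftOrthogonal _ (rot_of_distTriang _ hT) hE
    ((shiftsOf_leftOrthogonal_shift_iff (Z := Set.Iio (-1)) 1
      (fun n => by simp; lia)).2 fun Z f hZ => hX' f (hZ.imp_right
        (fun ⟨y, n, (hn : n < -1), e⟩ => ⟨y, n, show n < 0 by lia, e⟩)))) hY'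
  have : IsIso f := (Triangle.isZero₃_iff_isIso₁ _ hT).1 hY₀
  exact ⟨n, prop_of_iso _ (asIso f) hX⟩

lemma IsSimpleMinded.exists_iter_of_Ici [IsTriangulated D] (hΔ : IsSimpleMinded Δ)
    (hN : IsDualFamily Δ N) {E : D} (hE : (shiftsOf N (Set.Ici 0)).leftOrthogonal E) :
    ∃ n, (shiftsOf Δ (Set.Iio 0)).extensionProductIter n E := by
  obtain ⟨m, n, X, Y, hX, hY, hX', hY', f, g, h, hT⟩ := hΔ.exists_triangle hN E
  have := iter_isClosedUnderIsomorphisms (shiftsOf Δ (Set.Iio 0)) m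
  have hX₀ : IsZero X := hN.isZero_of_leftOrthogonal hX' (ext_of_isTriangulatedClosed₂
    (shiftsOf N (Set.Ici 0)).leftOrthogonal _ (inv_rot_of_distTriang _ hT)
    ((shiftsOf_leftOrthogonal_shift_iff (Z := Set.Ici 1) (-1)
      (fun n => by simp)).2 fun Z f hZ => hY' f (hZ.imp_right
        (fun ⟨y, n, (hn : 1 ≤ n), e⟩ => ⟨y, n, show 0 ≤ n by lia, e⟩))) hE)
  have : IsIso g := (Triangle.isZero₁_iff_isIso₂ _ hT).1 hX₀
  exact ⟨m, prop_of_iso _ (asIso g).symm hY⟩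

/-- Dévissage in both variables reduces this to the absence of negative extensions. -/
lemma IsSimpleMinded.iter_hom_eq_zero (hΔ : IsSimpleMinded Δ) {m n : ℕ} {X Y : D}
    (hX : (shiftsOf Δ (Set.Ici 0)).extensionProductIter n X)
    (hY : (shiftsOf Δ (Set.Iio 0)).extensionProductIter m Y) (f : X ⟶ Y) : f = 0 := by
  refine extensionProductIter_le_of_isTriangulatedClosed₂ (Q := leftOrthogonal _) _ ?_ n X hX f hY
  intro X' hX' Y' g hY'
  refine extensionProductIter_le_of_isTriangulatedClosed₂ (Q := rightOrthogonal _) _ ?_ m Y' hY'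
    g hX'
  rintro Y'' hY'' X'' g (hX'' | ⟨x, a, ha, ⟨e⟩⟩)
  · exact hX''.eq_of_src _ _
  obtain hY'' | ⟨y, b, hb, ⟨e'⟩⟩ := hY''
  · exact hY''.eq_of_tgt _ _
  have ha' : 0 ≤ a := ha
  have hb' : b < 0 := hb
  rw [← cancel_epi e.inv, ← cancel_mono e'.hom, comp_zero, zero_comp]
  exact eq_zero_of_shift (c := b - a) (by lia) (hΔ.hom_neg x y _ (by lia)) _

/-- The t-structure attached to a simple-minded family which admits a dual family. -/
def IsSimpleMinded.tStructure [IsTriangulated D] (hΔ : IsSimpleMinded Δ)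
    (hN : IsDualFamily Δ N) : TStructure D where
  le n := (shiftsOf N (Set.Iio (-n))).leftOrthogonal
  ge n := (shiftsOf N (Set.Ioi (-n))).leftOrthogonal
  le_shift n a n' h X hX :=
    (shiftsOf_leftOrthogonal_shift_iff a (fun m => by simp; lia)).2 hX
  ge_shift n a n' h X hX :=
    (shiftsOf_leftOrthogonal_shift_iff a (fun m => by simp; lia)).2 hX
  -- Orthogonality to shifts of `N` is first turned into a presentation by shifts of `Δ`, where the
  -- vanishing is known.
  zero' X Y f hX hY := by
    obtain ⟨n, hn⟩ := hΔ.exists_iter_of_Iio hN (by simpa using hX)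
    obtain ⟨m, hm⟩ := hΔ.exists_iter_of_Ici hN (E := Y) (shiftsOf_leftOrthogonal_iff.2
      fun y n hn => shiftsOf_leftOrthogonal_iff.1 hY y n (by simp at hn ⊢; lia))
    exact hΔ.iter_hom_eq_zero hn hm f
  le_zero_le X hX := shiftsOf_leftOrthogonal_iff.2
      fun y n hn => shiftsOf_leftOrthogonal_iff.1 hX y n (by simp at hn ⊢; lia)
  ge_one_le X hX := shiftsOf_leftOrthogonal_iff.2
      fun y n hn => shiftsOf_leftOrthogonal_iff.1 hX y n (by simp at hn ⊢; lia)
  exists_triangle_zero_one E := by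
    obtain ⟨m, n, X, Y, hX, hY, hX', hY', f, g, h, hT⟩ := hΔ.exists_triangle hN E
    exact ⟨X, Y, by simpa using hX', shiftsOf_leftOrthogonal_iff.2
      fun y n hn => shiftsOf_leftOrthogonal_iff.1 hY' y n (by simp at hn ⊢; lia), f, g, h, hT⟩

lemma le_eq_leftOrthogonal_ge (t : TStructure D) (m n : ℤ) (h : m + 1 = n) :
    t.le m = (t.ge n).leftOrthogonal := by
  ext X
  rw [t.le_iff_isLE, t.isLE_iff_orthogonal m n h]
  exact ⟨fun H Y f hY => H Y f ⟨hY⟩, fun H Y f hY => H f hY.ge⟩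

theorem IsSimpleMinded.tStructure_characterization [IsTriangulated D] (hΔ : IsSimpleMinded Δ) (hN : IsDualFamily Δ N) :
    (∃ t : TStructure D, t.ge 0 = (shiftsOf N (Set.Ioi 0)).leftOrthogonal) ∧
    ∀ t : TStructure D, t.ge 0 = (shiftsOf N (Set.Ioi 0)).leftOrthogonal →
      t.le (-1) = (shiftsOf N (Set.Ioi 0)).leftOrthogonal.leftOrthogonal ∧
      (shiftsOf N (Set.Ioi 0)).leftOrthogonal.leftOrthogonal =
        (shiftsOf N (Set.Iic 0)).leftOrthogonal ∧
      ∀ X, t.heart X ↔ (shiftsOf N {0}ᶜ).leftOrthogonal X := by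
  have h₁ : (hΔ.tStructure hN).ge 0 = (shiftsOf N (Set.Ioi 0)).leftOrthogonal := by
    simp [IsSimpleMinded.tStructure]
  have h₂ : (shiftsOf N (Set.Ioi 0)).leftOrthogonal.leftOrthogonal =
      (shiftsOf N (Set.Iic 0)).leftOrthogonal := by
    rw [← h₁, ← le_eq_leftOrthogonal_ge _ (-1) 0 (by simp)]
    have : Set.Iio (1 : ℤ) = Set.Iic 0 := by ext; simp; lia
    simp [IsSimpleMinded.tStructure, this]
  refine ⟨⟨_, h₁⟩, fun t ht => ?_⟩
  have h₃ : t.le (-1) = (shiftsOf N (Set.Ioi 0)).leftOrthogonal.leftOrthogonal := by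
    rw [← ht, le_eq_leftOrthogonal_ge _ (-1) 0 (by simp)]
  refine ⟨h₃, h₂, fun X => ?_⟩
  -- `X` is in `t.le 0` exactly when `X[1]` is in `t.le (-1)`.
  have h₄ : t.le 0 X ↔ (shiftsOf N (Set.Iio 0)).leftOrthogonal X := by
    rw [← shiftsOf_leftOrthogonal_shift_iff (Z' := Set.Iic 0) 1 (fun n => by simp; lia), ← h₂,
      ← h₃, ← prop_shift_iff (t.le (-1)), t.shift_le 1 (-1) 0 (by simp)]
  rw [TStructure.heart, prop_inf_iff, h₄, ht]
  simp only [shiftsOf_leftOrthogonal_iff]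
  refine ⟨fun H y n hn => ?_, fun H => ⟨fun y n hn => H y n ?_, fun y n hn => H y n ?_⟩⟩
  · obtain h | h := lt_or_gt_of_ne hn
    · exact H.1 y n h
    · exact H.2 y n h
  · exact ne_of_lt hn
  · exact ne_of_gt hn

end SimpleMinded

/-! ### Simple subquotients, covers and envelopes -/

section Subquotients

variable {C : Type u} [Category.{v} C]

lemma IsSubquotient.of_mono {S X Y : C} (h : IsSubquotient S X) (i : X ⟶ Y) [Mono i] :
    IsSubquotient S Y := by
  obtain ⟨T, j, q, hj, hq⟩ := h
  exact ⟨T, j ≫ i, q, mono_comp _ _, hq⟩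

variable {W : Type*} {L : W → C} {Z : Set W}

lemma supportedOn.of_mono {X Y : C} (h : supportedOn L Z Y) (i : X ⟶ Y) [Mono i] :
    supportedOn L Z X :=
  fun y hy => h y (hy.of_mono i)

variable [Abelian C]

lemma IsSubquotient.of_epi {S X Y : C} (h : IsSubquotient S Y) (p : X ⟶ Y) [Epi p] :
    IsSubquotient S X := by
  obtain ⟨T, j, q, hj, hq⟩ := h
  exact ⟨pullback p j, pullback.fst p j, pullback.snd p j ≫ q, inferInstance, epi_comp _ _⟩

lemma kernel_factorThruImage_comp {X Y : C} (f : X ⟶ Y) :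
    kernel.ι (Abelian.factorThruImage f) ≫ f = 0 := by
  have h := kernel.condition_assoc (Abelian.factorThruImage f) (Abelian.image.ι f)
  rw [Abelian.image.fac] at h
  rw [h, zero_comp]

/-- A simple subquotient of an extension is a subquotient of one of the two parts. -/
lemma IsSubquotient.of_shortExact {S : C} [Simple S] {E : ShortComplex C} (hE : E.ShortExact)
    (h : IsSubquotient S E.X₂) : IsSubquotient S E.X₁ ∨ IsSubquotient S E.X₃ := by
  obtain ⟨T, j, q, hj, hq⟩ := h
  have := hE.mono_f
  let k := kernel.ι (j ≫ E.g)
  -- Either `q` kills the part of `T` coming from `E.X₁` and descends to the image of `T` in `E.X₃`,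
  -- or that part already surjects onto the simple object `S`.
  by_cases hk : k ≫ q = 0
  · right
    let φ := Abelian.factorThruImage (j ≫ E.g)
    have hφ : kernel.ι φ ≫ q = 0 := by
      rw [← kernel.lift_ι _ _ (kernel_factorThruImage_comp (j ≫ E.g)), Category.assoc]
      change _ ≫ k ≫ q = 0
      rw [hk, comp_zero]
    have hq' : φ ≫ Abelian.epiDesc φ q hφ = q := Abelian.comp_epiDesc _ _ _
    have : Epi (φ ≫ Abelian.epiDesc φ q hφ) := by rwa [hq']
    exact ⟨_, Abelian.image.ι (j ≫ E.g), Abelian.epiDesc φ q hφ, inferInstance,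
      epi_of_epi φ _⟩
  · left
    have : Epi (k ≫ q) := epi_of_nonzero_to_simple hk
    have hl : (k ≫ j) ≫ E.g = 0 := by rw [Category.assoc, kernel.condition]
    have hm : hE.exact.lift (k ≫ j) hl ≫ E.f = k ≫ j := hE.exact.lift_f _ _
    have : Mono (hE.exact.lift (k ≫ j) hl ≫ E.f) := by rw [hm]; exact mono_comp _ _
    exact ⟨_, hE.exact.lift (k ≫ j) hl, k ≫ q, mono_of_mono _ E.f, inferInstance⟩

lemma supportedOn.of_epi {X Y : C} (h : supportedOn L Z X) (p : X ⟶ Y) [Epi p] :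
    supportedOn L Z Y :=
  fun y hy => h y (hy.of_epi p)

lemma supportedOn.of_shortExact (hL : ∀ y, Simple (L y)) {E : ShortComplex C} (hE : E.ShortExact)
    (h₁ : supportedOn L Z E.X₁) (h₃ : supportedOn L Z E.X₃) : supportedOn L Z E.X₂ := by
  intro y hy
  have := hL y
  exact (hy.of_shortExact hE).elim (h₁ y) (h₃ y)

/-- Dévissage: a property of objects which is closed under extensions and holds for the simple
objects `L y` with `y ∈ Z` holds for all objects of finite length supported on `Z`. -/
lemma supportedOn.induction (hN : ∀ X : C, IsNoetherianObject X) (hA : ∀ X : C, IsArtinianObject X)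
    (hS : ∀ S : C, Simple S → ∃ y, Nonempty (S ≅ L y)) {T : ObjectProperty C}
    [T.IsClosedUnderIsomorphisms] (hT₀ : ∀ X, IsZero X → T X)
    (hT : ∀ E : ShortComplex C, E.ShortExact → T E.X₁ → T E.X₃ → T E.X₂)
    (hL : ∀ y ∈ Z, T (L y)) {X : C} (hX : supportedOn L Z X) : T X := by
  have := hN X
  suffices ∀ Y : Subobject X, T (Y : C) → T X from
    this ⊥ (hT₀ _ ((isZero_zero C).of_iso Subobject.botCoeIsoZero))
  -- Noetherian induction on a subobject `Y` having `T`: if `Y` is proper, it is enlarged to the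
  -- preimage of a simple subobject of the quotient, which exists by the artinian condition.
  intro Y
  induction Y using WellFoundedGT.induction with
  | ind Y ih =>
    intro hY
    have := hA (cokernel Y.arrow)
    by_cases hQ : IsZero (cokernel Y.arrow)
    · have : Epi Y.arrow := Preadditive.epi_of_isZero_cokernel _ hQ
      have : IsIso Y.arrow := isIso_of_mono_of_epi _
      exact T.prop_of_iso (asIso Y.arrow) hY
    let s := simpleSubobjectArrow hQ
    let p := cokernel.π Y.arrow
    let f : (Y : C) ⟶ pullback p s := pullback.lift Y.arrow 0 (by simp [p])
    have hf : f ≫ pullback.fst p s = Y.arrow := pullback.lift_fst _ _ _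
    have hf' : f ≫ pullback.snd p s = 0 := pullback.lift_snd _ _ _
    have : Mono (f ≫ pullback.fst p s) := by rw [hf]; infer_instance
    have : Mono f := mono_of_mono f (pullback.fst p s)
    let E : ShortComplex C := ShortComplex.mk f (pullback.snd p s) hf'
    have hE : E.ShortExact := by
      have : Mono E.f := ‹Mono f›
      have : Epi E.g := inferInstanceAs (Epi (pullback.snd p s))
      suffices E.Exact from .mk this
      refine ShortComplex.exact_of_f_is_kernel _
        (KernelFork.IsLimit.ofι' (f := E.g) E.f E.zero fun k hk => ?_)
      have hk' : (k ≫ pullback.fst p s) ≫ cokernel.π Y.arrow = 0 := by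
        change (k ≫ pullback.fst p s) ≫ p = 0
        rw [Category.assoc, pullback.condition]
        change k ≫ E.g ≫ s = 0
        rw [reassoc_of% hk, zero_comp]
      refine ⟨Abelian.monoLift Y.arrow _ hk', ?_⟩
      rw [← cancel_mono (pullback.fst p s), Category.assoc]
      change _ ≫ f ≫ _ = _
      rw [hf]
      exact Abelian.monoLift_comp _ _ _
    have hT' : T (pullback p s) := by
      refine hT E hE hY ?_
      obtain ⟨y, ⟨e⟩⟩ := hS (simpleSubobject hQ) inferInstance
      refine T.prop_of_iso e.symm (hL y (hX y ?_))
      exact ⟨pullback p s, pullback.fst p s, pullback.snd p s ≫ e.hom, inferInstance,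
        epi_comp _ _⟩
    refine ih (Subobject.mk (pullback.fst p s)) ?_
      (T.prop_of_iso (Subobject.underlyingIso (pullback.fst p s)).symm hT')
    refine lt_of_le_of_ne (Subobject.le_mk_of_comm f hf) fun h => ?_
    have h0 : IsZero (simpleSubobject hQ) := by
      have hfst : pullback.fst p s ≫ p = 0 := by
        have h1 : pullback.fst p s = Subobject.ofMkLE _ _ h.ge ≫ Y.arrow := by simp
        rw [h1, Category.assoc, cokernel.condition, comp_zero]
      have h2 : pullback.snd p s = 0 := by
        rw [← cancel_mono s, ← pullback.condition, hfst, zero_comp]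
      exact IsZero.of_epi_eq_zero _ h2
    exact Simple.not_isZero _ h0

/-- If `kernel f` did not die in `S`, it would surject onto `S`, hence onto `M` by essentiality, and
`f` would vanish. -/
lemma IsProjectiveCoverIn.exists_factor {P : ObjectProperty C} {M S : C} [Simple S] {π : M ⟶ S}
    (h : IsProjectiveCoverIn P π) {Y : C} {f : M ⟶ Y} (hf : f ≠ 0) :
    ∃ t : Abelian.image f ⟶ S, Abelian.factorThruImage f ≫ t = π := by
  by_cases h0 : kernel.ι f ≫ π = 0
  · have h1 : kernel.ι (Abelian.factorThruImage f) ≫ π = 0 := by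
      rw [← kernel.lift_ι _ _ (kernel_factorThruImage_comp f), Category.assoc, h0, comp_zero]
    exact ⟨Abelian.epiDesc _ π h1, Abelian.comp_epiDesc _ _ _⟩
  · have : Epi (kernel.ι f) := h.essential _ (epi_of_nonzero_to_simple h0)
    exact absurd (by rw [← cancel_epi (kernel.ι f), kernel.condition, comp_zero]) hf

lemma IsInjectiveEnvelopeIn.exists_factor {P : ObjectProperty C} {S A : C} [Simple S] {ι : S ⟶ A}
    (h : IsInjectiveEnvelopeIn P ι) {X : C} {f : X ⟶ A} (hf : f ≠ 0) :
    ∃ t : S ⟶ Abelian.image f, t ≫ Abelian.image.ι f = ι := by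
  by_cases h0 : ι ≫ cokernel.π f = 0
  · exact ⟨kernel.lift _ _ h0, kernel.lift_ι _ _ _⟩
  · have : Mono (cokernel.π f) := h.essential _ (mono_of_nonzero_from_simple h0)
    exact absurd (by rw [← cancel_mono (cokernel.π f), cokernel.condition, zero_comp]) hf

lemma IsProjectiveCoverIn.isSubquotient {P : ObjectProperty C} {M S : C} [Simple S] {π : M ⟶ S}
    (h : IsProjectiveCoverIn P π) {Y : C} {f : M ⟶ Y} (hf : f ≠ 0) : IsSubquotient S Y := by
  obtain ⟨t, ht⟩ := h.exists_factor hf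
  have := h.epi
  have : Epi (Abelian.factorThruImage f ≫ t) := by rwa [ht]
  exact ⟨_, Abelian.image.ι f, t, inferInstance, epi_of_epi (Abelian.factorThruImage f) t⟩

lemma IsInjectiveEnvelopeIn.isSubquotient {P : ObjectProperty C} {S A : C} [Simple S] {ι : S ⟶ A}
    (h : IsInjectiveEnvelopeIn P ι) {X : C} {f : X ⟶ A} (hf : f ≠ 0) : IsSubquotient S X := by
  obtain ⟨t, ht⟩ := h.exists_factor hf
  have := h.mono
  have : Mono (t ≫ Abelian.image.ι f) := by rwa [ht]
  have : Mono t := mono_of_mono t (Abelian.image.ι f)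
  exact IsSubquotient.of_epi ⟨S, t, 𝟙 S, inferInstance, inferInstance⟩ (Abelian.factorThruImage f)

/-- The pushout of a short exact sequence. -/
lemma shortExact_pushout {K P M A : C} {i : K ⟶ P} {p : P ⟶ M} (hip : i ≫ p = 0)
    (h : (ShortComplex.mk i p hip).ShortExact) (g : K ⟶ A) :
    (ShortComplex.mk (pushout.inr i g) (pushout.desc p 0 (by simp [hip]))
      (pushout.inr_desc _ _ _)).ShortExact := by
  have : Mono i := h.mono_f
  have : Epi p := h.epi_g
  have : Mono (pushout.inr i g) := inferInstance
  have hd : pushout.inl i g ≫ pushout.desc p 0 (by simp [hip]) = p := pushout.inl_desc _ _ _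
  have : Epi (pushout.inl i g ≫ pushout.desc p (0 : A ⟶ M) (by simp [hip])) := by rwa [hd]
  have : Epi (pushout.desc p (0 : A ⟶ M) (by simp [hip] : i ≫ p = g ≫ 0)) :=
    epi_of_epi (pushout.inl i g) _
  suffices ShortComplex.Exact _ from .mk this
  refine ShortComplex.exact_of_g_is_cokernel _ (CokernelCofork.IsColimit.ofπ' _ _ fun {Z} k hk => ?_)
  have hk' : i ≫ pushout.inl i g ≫ k = 0 := by
    rw [pushout.condition_assoc]
    dsimp at hk
    rw [hk, comp_zero]
  refine ⟨h.exact.desc (pushout.inl i g ≫ k) hk', ?_⟩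
  apply pushout.hom_ext
  · rw [← Category.assoc]
    erw [hd]
    exact h.exact.g_desc _ _
  · rw [← Category.assoc]
    erw [pushout.inr_desc]
    rw [zero_comp]
    exact hk.symm

end Subquotients

/-! ### Composition factors of standard and costandard objects -/

namespace HighestWeightCategory

variable {k : Type*} [Field k] {C : Type u} [Category.{v} C] [Abelian C] [Linear k C]
  {W : Type*} [PartialOrder W] (H : HighestWeightCategory k C W)

lemma isSubquotient_simple_iff (x y : W) (h : IsSubquotient (H.L x) (H.L y)) : x = y := by
  have := H.simple x
  have := H.simple y
  obtain ⟨T, i, q, hi, hq⟩ := h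
  have hi0 : i ≠ 0 := by
    intro h0
    have : IsZero T := IsZero.of_mono_eq_zero i h0
    exact Simple.not_isZero (H.L x) (IsZero.of_epi q this)
  have : IsIso i := isIso_of_mono_of_nonzero hi0
  have hq0 : inv i ≫ q ≠ 0 := fun h0 => Simple.not_isZero (H.L x)
    (IsZero.of_epi_eq_zero q (by simpa using h0))
  have : IsIso (inv i ≫ q) := isIso_of_hom_simple hq0
  exact H.eq_of_iso x y ⟨(asIso (inv i ≫ q)).symm⟩

lemma supportedOn_simple (y : W) (Z : Set W) (h : y ∈ Z) : supportedOn H.L Z (H.L y) :=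
  fun x hx => by rwa [H.isSubquotient_simple_iff x y hx]

/-- If `L y` occurred in the kernel, lifting `π y` would give a nonzero endomorphism of `M y` with
image in the kernel; but endomorphisms are scalars, and a nonzero scalar does not kill `π y`. -/
lemma supportedOn_kernel (y : W) : supportedOn H.L (Set.Iio y) (kernel (H.π y)) := by
  intro x hx
  have hxy : x ≤ y := (H.isProjectiveCover y).mem x (hx.of_mono (kernel.ι _))
  refine lt_of_le_of_ne hxy ?_
  rintro rfl
  have := H.simple x
  have hπ := (H.isProjectiveCover x).epi
  obtain ⟨T, i, q, hi, hq⟩ := hx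
  have hT : supportedOn H.L (Set.Iic x) T :=
    (H.isProjectiveCover x).mem.of_mono (i ≫ kernel.ι (H.π x))
  obtain ⟨g, hg⟩ := (H.isProjectiveCover x).lifting hT
    (H.supportedOn_simple x _ le_rfl) (H.π x) q hq
  obtain ⟨c, hc⟩ := (H.end_standard x).surjective (g ≫ i ≫ kernel.ι (H.π x))
  have hπ0 : H.π x ≠ 0 := fun h0 => Simple.not_isZero (H.L x) (IsZero.of_epi_eq_zero _ h0)
  have h1 : c • H.π x = 0 := by
    have := congr($hc ≫ H.π x)
    simpa using this
  obtain rfl | h0 := smul_eq_zero.1 h1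
  · have h2 : (g ≫ i) ≫ kernel.ι (H.π x) = 0 := by simpa using hc.symm
    have h3 : g ≫ i = 0 := by rwa [← cancel_mono (kernel.ι (H.π x)), zero_comp]
    have h4 : g = 0 := by rwa [← cancel_mono i, zero_comp]
    exact hπ0 (by rw [← hg, h4, zero_comp])
  · exact hπ0 h0

/-- Nothing is assumed on `End(A y)`, so this is drawn from `M y`. A map `M y ⟶ A y` kills `kernel
(π y)`, where `L y` does not occur, so it factors through `L y` and lands in the socle. By lifting,
every map from `M y` to the cokernel is zero, whereas an occurrence of `L y` would give a nonzero
one. -/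
lemma supportedOn_cokernel (y : W) : supportedOn H.L (Set.Iio y) (cokernel (H.ι y)) := by
  intro x hx
  have hxy : x ≤ y := (H.isInjectiveEnvelope y).mem x (hx.of_epi (cokernel.π _))
  refine lt_of_le_of_ne hxy ?_
  rintro rfl
  have := H.simple x
  have hπ := (H.isProjectiveCover x).epi
  have hπ0 : H.π x ≠ 0 := fun h0 => Simple.not_isZero (H.L x) (IsZero.of_epi_eq_zero _ h0)
  obtain ⟨T, i, q, hi, hq⟩ := hx
  have hT : supportedOn H.L (Set.Iic x) T :=
    ((H.isInjectiveEnvelope x).mem.of_epi (cokernel.π (H.ι x))).of_mono i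
  obtain ⟨g, hg⟩ := (H.isProjectiveCover x).lifting hT
    (H.supportedOn_simple x _ le_rfl) (H.π x) q hq
  obtain ⟨g', hg'⟩ := (H.isProjectiveCover x).lifting (H.isInjectiveEnvelope x).mem
    ((H.isInjectiveEnvelope x).mem.of_epi (cokernel.π (H.ι x))) (g ≫ i) (cokernel.π (H.ι x))
    inferInstance
  have hk : kernel.ι (H.π x) ≫ g' = 0 := by
    by_contra h0
    exact lt_irrefl x (H.supportedOn_kernel x x ((H.isInjectiveEnvelope x).isSubquotient h0))
  let a := Abelian.epiDesc (H.π x) g' hk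
  have ha : H.π x ≫ a = g' := Abelian.comp_epiDesc _ _ _
  suffices a ≫ cokernel.π (H.ι x) = 0 by
    have h1 : g ≫ i = 0 := by rw [← hg', ← ha, Category.assoc, this, comp_zero]
    have h4 : g = 0 := by rwa [← cancel_mono i, zero_comp]
    exact hπ0 (by rw [← hg, h4, zero_comp])
  by_cases ha0 : a = 0
  · rw [ha0, zero_comp]
  -- The image of `a` is simple and contains that of `ι x`, so the two agree.
  obtain ⟨t, ht⟩ := (H.isInjectiveEnvelope x).exists_factor ha0
  have : Mono a := mono_of_nonzero_from_simple ha0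
  have hfac : Abelian.factorThruImage a ≫ Abelian.image.ι a = a := Abelian.image.fac a
  have : IsIso (Abelian.factorThruImage a) := isIso_of_mono_of_epi _
  have hιt : (t ≫ inv (Abelian.factorThruImage a)) ≫ a = H.ι x := by
    have h1 : inv (Abelian.factorThruImage a) ≫ a = Abelian.image.ι a := by
      rw [IsIso.inv_comp_eq, hfac]
    rw [Category.assoc, h1, ht]
  have hιm := (H.isInjectiveEnvelope x).mono
  have ht0 : t ≫ inv (Abelian.factorThruImage a) ≠ 0 := fun h0 =>
    Simple.not_isZero (H.L x) (IsZero.of_mono_eq_zero (H.ι x) (by rw [← hιt, h0, zero_comp]))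
  have : IsIso (t ≫ inv (Abelian.factorThruImage a)) := isIso_of_hom_simple ht0
  rw [← cancel_epi (t ≫ inv (Abelian.factorThruImage a)), ← Category.assoc, hιt,
    cokernel.condition, comp_zero]

/-- A nonzero map makes `L x` occur in `A y` and `L y` in `M x`, so `x ≤ y ≤ x`. -/
lemma hom_standard_costandard_eq_zero {x y : W} (hxy : x ≠ y) (f : H.M x ⟶ H.A y) : f = 0 := by
  have := H.simple x
  have := H.simple y
  by_contra h0
  exact hxy (le_antisymm
    ((H.isInjectiveEnvelope y).mem x ((H.isProjectiveCover x).isSubquotient h0))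
    ((H.isProjectiveCover x).mem y ((H.isInjectiveEnvelope y).isSubquotient h0)))

/-- Morphisms to `A y` extend along subobjects with quotient `M x`, if `x ≤ y`. -/
lemma exists_extension {x y : W} (hxy : x ≤ y) {K P : C} {i : K ⟶ P} {p : P ⟶ H.M x}
    (hip : i ≫ p = 0) (h : (ShortComplex.mk i p hip).ShortExact) (g : K ⟶ H.A y) :
    ∃ g' : P ⟶ H.A y, i ≫ g' = g := by
  have h' := shortExact_pushout hip h g
  have hM : supportedOn H.L (Set.Iic y) (H.M x) :=
    fun z hz => le_trans ((H.isProjectiveCover x).mem z hz) hxy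
  -- The pushout extension of `M x` by `A y` stays in the subcategory attached to `y`, where `A y`
  -- is injective; so it splits.
  obtain ⟨r, hr⟩ := (H.isInjectiveEnvelope y).extension (H.isInjectiveEnvelope y).mem
    (supportedOn.of_shortExact H.simple h' (H.isInjectiveEnvelope y).mem hM) (𝟙 _)
    (pushout.inr i g) h'.mono_f
  exact ⟨pushout.inl i g ≫ r, by rw [pushout.condition_assoc, hr, Category.comp_id]⟩

end HighestWeightCategory

/-! ### Extensions in the bounded derived category -/

section Bounded

open Pretriangulated ObjectProperty DerivedCategory

lemma distinguished_fullSubcategory {D : Type*} [Category* D] [HasZeroObject D] [HasShift D ℤ]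
    [Preadditive D] [∀ n : ℤ, (shiftFunctor D n).Additive] [Pretriangulated D]
    (P : ObjectProperty D) [P.IsTriangulated] {X Y Z : P.FullSubcategory} (f : X.obj ⟶ Y.obj)
    (g : Y.obj ⟶ Z.obj) (h : Z.obj ⟶ X.obj⟦(1 : ℤ)⟧) (hT : Triangle.mk f g h ∈ distTriang D) :
    Triangle.mk (homMk f : X ⟶ Y) (homMk g : Y ⟶ Z)
      (homMk (h ≫ (P.ι.commShiftIso (1 : ℤ)).inv.app X) : Z ⟶ X⟦(1 : ℤ)⟧) ∈
        distTriang P.FullSubcategory := by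
  refine isomorphic_distinguished _ hT _
    (Triangle.isoMk _ _ (Iso.refl _) (Iso.refl _) (Iso.refl _) ?_ ?_ ?_)
  · change f ≫ 𝟙 _ = 𝟙 _ ≫ f
    rw [Category.comp_id, Category.id_comp]
  · change g ≫ 𝟙 _ = 𝟙 _ ≫ g
    rw [Category.comp_id, Category.id_comp]
  · have h₁ : (h ≫ (P.ι.commShiftIso (1 : ℤ)).inv.app X) ≫ (P.ι.commShiftIso (1 : ℤ)).hom.app X =
        h := by
      rw [Category.assoc, Iso.inv_hom_id_app]
      exact Category.comp_id h
    have h₂ : h ≫ (shiftFunctor D (1 : ℤ)).map (𝟙 X.obj) = h := by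
      rw [CategoryTheory.Functor.map_id, Category.comp_id]
    exact ((congrArg (· ≫ (shiftFunctor D (1 : ℤ)).map (𝟙 X.obj)) h₁).trans h₂).trans
      (Category.id_comp h).symm

variable {C : Type u} [Category.{v} C] [Abelian C] [HasDerivedCategory.{w} C]

/-- The functoriality of `single`. -/
noncomputable def singleMap {X Y : C} (f : X ⟶ Y) : single X ⟶ single Y :=
  homMk ((singleFunctor C 0).map f)

lemma singleMap_comp {X Y Z : C} (f : X ⟶ Y) (g : Y ⟶ Z) :
    singleMap (f ≫ g) = singleMap f ≫ singleMap g := by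
  ext
  exact (singleFunctor C 0).map_comp f g

lemma singleMap_id (X : C) : singleMap (𝟙 X) = 𝟙 (single X) := by
  ext
  exact (singleFunctor C 0).map_id X

lemma singleMap_zero (X Y : C) : singleMap (0 : X ⟶ Y) = 0 := by
  ext
  exact (singleFunctor C 0).map_zero X Y

lemma singleMap_surjective {X Y : C} (f : single X ⟶ single Y) : ∃ g : X ⟶ Y, singleMap g = f := by
  obtain ⟨g, hg⟩ := (singleFunctor C 0).map_surjective f.hom
  refine ⟨g, ?_⟩
  ext
  exact hg

/-- The image of an isomorphism by `single`. -/
noncomputable def singleIso {X Y : C} (e : X ≅ Y) : single X ≅ single Y where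
  hom := singleMap e.hom
  inv := singleMap e.inv
  hom_inv_id := by rw [← singleMap_comp, e.hom_inv_id, singleMap_id]
  inv_hom_id := by rw [← singleMap_comp, e.inv_hom_id, singleMap_id]

lemma isZero_single {X : C} (hX : IsZero X) : IsZero (single X) := by
  rw [IsZero.iff_id_eq_zero, ← singleMap_id, hX.eq_of_src (𝟙 X) 0, singleMap_zero]

lemma exists_single_triangle {S : ShortComplex C} (hS : S.ShortExact) :
    ∃ δ : single S.X₃ ⟶ (single S.X₁)⟦(1 : ℤ)⟧,
      Triangle.mk (singleMap S.f) (singleMap S.g) δ ∈ distTriang (Bounded C) :=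
  ⟨_, distinguished_fullSubcategory (X := single S.X₁) (Y := single S.X₂) (Z := single S.X₃)
    _ _ _ _ hS.singleTriangle_distinguished⟩

/-- All the objects of a triangulated subcategory of the bounded derived category
which contains the objects of `C`. -/
lemma bounded_induction (T : ObjectProperty (Bounded C)) [T.IsTriangulated]
    [T.IsClosedUnderIsomorphisms] (hT : ∀ X : C, T (single X)) (X : Bounded C) : T X := by
  suffices ∀ (n : ℕ) (a : ℤ) (X : Bounded C), X.obj.IsGE a → X.obj.IsLE (a + n) → T X by
    obtain ⟨Y, ⟨a, ha⟩, ⟨b, hb⟩⟩ := X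
    refine this (b - a).toNat a _ ha ?_
    exact TStructure.t.isLE_of_le Y b _ (by lia)
  -- Induction on the cohomological amplitude, splitting off the lowest cohomology object.
  intro n
  induction n with
  | zero =>
    intro a X hX hX'
    have hX'' : X.obj.IsLE a := by simpa using hX'
    obtain ⟨Y, ⟨e⟩⟩ := X.obj.exists_iso_singleFunctor_obj_of_isGE_of_isLE a
    have e' : X.obj⟦a⟧ ≅ (singleFunctor C 0).obj Y :=
      (shiftFunctor _ a).mapIso e ≪≫ ((singleFunctors C).shiftIso a 0 a (by simp)).app Y
    rw [← T.prop_shift_iff_of_isStableUnderShift X a]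
    have e'' : X⟦a⟧ ≅ single Y :=
      isoMk _ (((Bounded.ι (C := C)).commShiftIso a).app X ≪≫ e')
    exact T.prop_of_iso e''.symm (hT Y)
  | succ n ih =>
    intro a X hX hX'
    have h₁ : ((TStructure.t.truncLT (a + 1)).obj X.obj).IsLE a := inferInstance
    have h₂ : ((TStructure.t.truncLT (a + 1)).obj X.obj).IsGE a := inferInstance
    have h₃ : ((TStructure.t.truncGE (a + 1)).obj X.obj).IsGE (a + 1) := inferInstance
    have h₄ : ((TStructure.t.truncGE (a + 1)).obj X.obj).IsLE (a + 1 + n) :=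
      TStructure.t.isLE_of_le _ (a + (n + 1 : ℕ)) _ (by push_cast; lia)
    let X₁ : Bounded C := ⟨(TStructure.t.truncLT (a + 1)).obj X.obj, ⟨a, h₂⟩, ⟨a, h₁⟩⟩
    let X₃ : Bounded C := ⟨(TStructure.t.truncGE (a + 1)).obj X.obj, ⟨_, h₃⟩, ⟨_, h₄⟩⟩
    have hT' := distinguished_fullSubcategory TStructure.t.bounded (X := X₁) (Y := X) (Z := X₃) _ _ _
      (TStructure.t.triangleLTGE_distinguished (a + 1) X.obj)
    refine T.ext_of_isTriangulatedClosed₂ _ hT' (ih a X₁ h₂ ?_) (ih (a + 1) X₃ h₃ h₄)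
    exact TStructure.t.isLE_of_le _ a _ (by lia)

/-- The vanishing of `Ext^n(X, Y)`. -/
def ExtVanish (X Y : C) (n : ℤ) : Prop := ∀ f : Ext (single X) Y n, f = 0

lemma ExtVanish.of_derivedCategory {X Y : C} {n : ℤ}
    (h : ∀ f : (singleFunctor C 0).obj X ⟶ ((singleFunctor C 0).obj Y)⟦n⟧, f = 0) :
    ExtVanish X Y n := by
  intro f
  apply (Bounded.ι (C := C)).map_injective
  rw [← cancel_mono (((Bounded.ι (C := C)).commShiftIso n).hom.app (single Y)), Functor.map_zero, zero_comp]
  exact h _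

lemma ExtVanish.of_neg (X Y : C) {n : ℤ} (hn : n < 0) : ExtVanish X Y n := by
  refine .of_derivedCategory fun f => ?_
  have := TStructure.t.isGE_shift ((singleFunctor C 0).obj Y) 0 n (-n) (by lia)
  exact TStructure.t.zero f 0 (-n) (by lia)

lemma ExtVanish.of_projective (P Y : C) (hP : Projective P) {n : ℤ} (hn : 0 < n) :
    ExtVanish P Y n := by
  refine .of_derivedCategory fun f => ?_
  let e := ((singleFunctors C).shiftIso n (-n) 0 (by lia)).app Y
  rw [← cancel_mono e.hom, zero_comp]
  rw [← cancel_epi ((singleFunctorIsoCompQ C 0).inv.app P),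
    ← cancel_mono ((singleFunctorIsoCompQ C (-n)).hom.app Y), comp_zero, zero_comp]
  exact from_singleFunctor_obj_eq_zero_of_projective
    (L := (CochainComplex.singleFunctor C (-n)).obj Y) _ (-n) (by lia)

lemma ExtVanish.of_hom {X Y : C} (h : ∀ f : X ⟶ Y, f = 0) : ExtVanish X Y 0 := by
  intro f
  rw [← cancel_mono ((shiftFunctorZero (Bounded C) ℤ).hom.app (single Y)), zero_comp]
  obtain ⟨g, hg⟩ := singleMap_surjective (f ≫ (shiftFunctorZero (Bounded C) ℤ).hom.app (single Y))
  rw [← hg, h g, singleMap_zero]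

lemma ExtVanish.of_shortExact₂ {S : ShortComplex C} (hS : S.ShortExact) {Y : C} {n : ℤ}
    (h₁ : ExtVanish S.X₁ Y n) (h₃ : ExtVanish S.X₃ Y n) : ExtVanish S.X₂ Y n := by
  obtain ⟨δ, hT⟩ := exists_single_triangle hS
  intro f
  obtain ⟨g, rfl⟩ : ∃ g : single S.X₃ ⟶ _, f = singleMap S.g ≫ g :=
    Triangle.yoneda_exact₂ _ hT f (h₁ _)
  rw [h₃ g, comp_zero]

lemma ExtVanish.of_shortExact₃ {S : ShortComplex C} (hS : S.ShortExact) {Y : C} {n : ℤ}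
    (h₁ : ExtVanish S.X₁ Y n) (h₂ : ExtVanish S.X₂ Y (n + 1)) : ExtVanish S.X₃ Y (n + 1) := by
  obtain ⟨δ, hT⟩ := exists_single_triangle hS
  intro f
  obtain ⟨g, rfl⟩ : ∃ g : (single S.X₁)⟦(1 : ℤ)⟧ ⟶ _, f = δ ≫ g :=
    Triangle.yoneda_exact₃ _ hT f (h₂ _)
  rw [eq_zero_of_shift (c := n) (by lia) h₁ g, comp_zero]

lemma ExtVanish.of_isFiltered {W : Type*} {M : W → C} {Z : Set W} {X Y : C} {n : ℤ}
    (hX : IsFiltered M Z X) (h : ∀ z ∈ Z, ExtVanish (M z) Y n) : ExtVanish X Y n := by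
  induction hX with
  | zero X hX => exact fun f => (isZero_single hX).eq_of_src _ _
  | step X' X x i p hip hx hS _ ih => exact .of_shortExact₂ hS ih (h x hx)

/-- As `Ext^1(P, Y) = 0`, each class comes from a map `K ⟶ Y`; this extends to `P`, and `δ ≫ i[1] =
0`. -/
lemma ExtVanish.of_extension {K P M Y : C} {i : K ⟶ P} {p : P ⟶ M} {hip : i ≫ p = 0}
    (h : (ShortComplex.mk i p hip).ShortExact) (hP : Projective P)
    (hY : ∀ g : K ⟶ Y, ∃ g' : P ⟶ Y, i ≫ g' = g) : ExtVanish M Y 1 := by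
  obtain ⟨δ, hT⟩ := exists_single_triangle h
  intro f
  obtain ⟨g, rfl⟩ : ∃ g : (single K)⟦(1 : ℤ)⟧ ⟶ _, f = δ ≫ g :=
    Triangle.yoneda_exact₃ _ hT f (ExtVanish.of_projective P Y hP one_pos _)
  obtain ⟨g, rfl⟩ := (shiftFunctor (Bounded C) (1 : ℤ)).map_surjective g
  obtain ⟨g, rfl⟩ := singleMap_surjective g
  obtain ⟨g', rfl⟩ := hY g
  have : δ ≫ (shiftFunctor (Bounded C) (1 : ℤ)).map (singleMap i) = 0 :=
    comp_distTriang_mor_zero₃₁ _ hT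
  rw [singleMap_comp, Functor.map_comp, reassoc_of% this, zero_comp]

end Bounded

/-! ### Ext vanishing, and the simple-minded family with its dual -/

namespace HighestWeightCategory

open Pretriangulated ObjectProperty DerivedCategory

variable {k : Type*} [Field k] {C : Type u} [Category.{v} C] [Abelian C] [Linear k C]
  {W : Type*} [PartialOrder W] (H : HighestWeightCategory k C W)

/-- The standard object `M x` is the quotient of a projective object by an object filtered by
standard objects `M y` with `y > x`. -/
lemma exists_projective_presentation (x : W) : ∃ (K P : C) (i : K ⟶ P) (p : P ⟶ H.M x)
    (hip : i ≫ p = 0), (ShortComplex.mk i p hip).ShortExact ∧ Projective P ∧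
      IsFiltered H.M (Set.Ioi x) K := by
  obtain ⟨P, q, p, hq, hpq, hK⟩ := H.exists_filtration x
  have hP : Projective P := ⟨fun f e he => hq.lifting trivial trivial f e he⟩
  have := hq.epi
  have hp : Epi p := (H.isProjectiveCover x).essential p (by rwa [hpq])
  exact ⟨kernel p, P, kernel.ι p, p, kernel.condition p,
    { exact := ShortComplex.exact_kernel p }, hP, hK⟩

lemma isIso_or_eq_zero (x : W) (f : H.M x ⟶ H.M x) : f = 0 ∨ IsIso f := by
  obtain ⟨c, rfl⟩ := (H.end_standard x).surjective f
  by_cases hc : c = 0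
  · exact Or.inl (by simp [hc])
  · refine Or.inr ⟨c⁻¹ • 𝟙 _, ?_, ?_⟩ <;> simp [smul_smul, hc]

/-- A triangulated property which holds for all simple objects `L y`, `y ∈ Z`, holds
for the objects of `C` which are supported on `Z`. -/
lemma single_induction [HasDerivedCategory.{w} C] (T : ObjectProperty (Bounded C))
    [T.IsTriangulated] [T.IsClosedUnderIsomorphisms] {Z : Set W}
    (hL : ∀ y ∈ Z, T (single (H.L y))) {X : C} (hX : supportedOn H.L Z X) : T (single X) := by
  let T' : ObjectProperty C := fun X => T (single X)
  have : T'.IsClosedUnderIsomorphisms := ⟨fun e h => T.prop_of_iso (singleIso e) h⟩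
  refine supportedOn.induction (T := T') H.noetherian H.artinian H.exists_iso
    (fun X hX => T.prop_of_isZero (isZero_single hX)) (fun E hE h₁ h₃ => ?_) hL hX
  obtain ⟨δ, hT⟩ := exists_single_triangle hE
  exact T.ext_of_isTriangulatedClosed₂ _ hT h₁ h₃

variable [HasDerivedCategory.{w} C]

lemma generates_of_simple (T : ObjectProperty (Bounded C)) [T.IsTriangulated]
    [T.IsClosedUnderIsomorphisms] (hT : ∀ y, T (single (H.L y))) (X : Bounded C) : T X :=
  bounded_induction T (fun _ => H.single_induction T (Z := Set.univ) (fun y _ => hT y)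
    (fun _ _ => trivial)) X

/-- Induction on `y`: `L y` is the cone of `kernel (π y) ⟶ M y`, and the kernel involves only
smaller simple objects. -/
lemma generates_of_standard [Finite W] (T : ObjectProperty (Bounded C)) [T.IsTriangulated]
    [T.IsClosedUnderIsomorphisms] (hT : ∀ y, T (single (H.M y))) (X : Bounded C) : T X := by
  refine H.generates_of_simple T (fun y => ?_) X
  induction y using WellFoundedLT.induction with
  | ind y ih =>
    have := (H.isProjectiveCover y).epi
    have hS : (ShortComplex.mk _ _ (kernel.condition (H.π y))).ShortExact :=
      { exact := ShortComplex.exact_kernel (H.π y) }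
    obtain ⟨δ, hδ⟩ := exists_single_triangle hS
    exact T.ext_of_isTriangulatedClosed₃ _ hδ
      (H.single_induction T ih (H.supportedOn_kernel y)) (hT y)

lemma generates_of_costandard [Finite W] (T : ObjectProperty (Bounded C)) [T.IsTriangulated]
    [T.IsClosedUnderIsomorphisms] (hT : ∀ y, T (single (H.A y))) (X : Bounded C) : T X := by
  refine H.generates_of_simple T (fun y => ?_) X
  induction y using WellFoundedLT.induction with
  | ind y ih =>
    have := (H.isInjectiveEnvelope y).mono
    have hS : (ShortComplex.mk _ _ (cokernel.condition (H.ι y))).ShortExact :=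
      { exact := ShortComplex.exact_cokernel (H.ι y) }
    obtain ⟨δ, hδ⟩ := exists_single_triangle hS
    exact T.ext_of_isTriangulatedClosed₁ _ hδ (hT y)
      (H.single_induction T ih (H.supportedOn_cokernel y))

/-- Dimension shifting along the projective presentations of the standard objects. -/
lemma extVanish_of_le {U : Set W} (hU : IsUpperSet U) {Y : C} {m : ℤ} (hm : 0 ≤ m)
    (h : ∀ x ∈ U, ExtVanish (H.M x) Y m) {n : ℤ} (hmn : m ≤ n) :
    ∀ x ∈ U, ExtVanish (H.M x) Y n := by
  induction n, hmn using Int.leInduction with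
  | base => exact h
  | succ n hn ih =>
    intro x hx
    obtain ⟨K, P, i, p, hip, hS, hP, hK⟩ := H.exists_projective_presentation x
    -- `K` is filtered by standard objects with larger index, which remain in the upper set `U`.
    exact .of_shortExact₃ hS (.of_isFiltered hK fun z hz => ih z (hU (le_of_lt hz) hx))
      (.of_projective P Y hP (by lia))

lemma isUpperSet_not_le (y : W) : IsUpperSet {x : W | ¬ x ≤ y} :=
  fun _ _ hab ha hb => ha (hab.trans hb)

lemma extVanish_standard {x y : W} (hxy : ¬ x ≤ y) (n : ℤ) : ExtVanish (H.M x) (H.M y) n := by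
  obtain hn | hn := lt_or_ge n 0
  · exact .of_neg _ _ hn
  · exact H.extVanish_of_le (isUpperSet_not_le y) le_rfl (fun z hz => .of_hom fun f => by
      by_contra hf
      exact hz (H.le_of_hom_ne_zero z y f hf)) hn x hxy

lemma extVanish_costandard_one (x y : W) : ExtVanish (H.M x) (H.A y) 1 := by
  by_cases hxy : x ≤ y
  · obtain ⟨K, P, i, p, hip, hS, hP, -⟩ := H.exists_projective_presentation x
    exact .of_extension hS hP (H.exists_extension hxy hip hS)
  · exact H.extVanish_of_le (isUpperSet_not_le y) le_rfl (fun z hz => .of_hom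
      (H.hom_standard_costandard_eq_zero fun h => hz h.le)) zero_le_one x hxy

/-- Dimension shifting starts in degree 1, not 0, because `Hom(M y, A y)` need not vanish. -/
lemma extVanish_costandard {x y : W} {n : ℤ} (h : x = y → n ≠ 0) :
    ExtVanish (H.M x) (H.A y) n := by
  obtain hn | rfl | hn := lt_trichotomy n 0
  · exact .of_neg _ _ hn
  · exact .of_hom (H.hom_standard_costandard_eq_zero fun hxy => h hxy rfl)
  · exact H.extVanish_of_le isUpperSet_univ zero_le_one
      (fun z _ => H.extVanish_costandard_one z y) hn x trivial

variable (ℓ : W → ℤ)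

/-- The standard objects, shifted so as to lie in the heart. -/
noncomputable def shiftedStandard (y : W) : Bounded C := (single (H.M y))⟦-ℓ y⟧

/-- The costandard objects, shifted so as to be dual to `shiftedStandard`. -/
noncomputable def shiftedCostandard (y : W) : Bounded C := (single (H.A y))⟦-ℓ y⟧

variable {ℓ}

/-- Unshifted, the degree is `ℓ x - ℓ y + n`. For `x ≤ y` monotonicity makes it negative when `n <
0`, and strictness does so for `n = 0`, `x ≠ y`; otherwise all degrees vanish. -/
lemma isSimpleMinded [Finite W] (hℓ : StrictMono ℓ) :
    IsSimpleMinded (H.shiftedStandard ℓ) where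
  hom_neg x y n hn f := by
    let e : (H.shiftedStandard ℓ y)⟦n⟧ ≅ (single (H.M y))⟦-ℓ y + n⟧ :=
      (shiftFunctorAdd' (Bounded C) (-ℓ y) n _ rfl).symm.app (single (H.M y))
    rw [← cancel_mono e.hom, zero_comp]
    refine eq_zero_of_shift (c := ℓ x - ℓ y + n) (by lia) ?_ (f ≫ e.hom)
    by_cases hxy : x ≤ y
    · have := hℓ.monotone hxy
      exact ExtVanish.of_neg _ _ (by lia)
    · exact H.extVanish_standard hxy _
  hom_zero x y f := by
    by_cases hxy : x = y
    · subst hxy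
      obtain ⟨g, rfl⟩ := (shiftFunctor (Bounded C) (-ℓ x)).map_surjective f
      obtain ⟨g, rfl⟩ := singleMap_surjective g
      obtain rfl | hg := H.isIso_or_eq_zero x g
      · left
        rw [singleMap_zero]
        exact Functor.map_zero _ _ _
      · right
        exact ((shiftFunctor (Bounded C) (-ℓ x)).mapIso (singleIso (asIso g))).isIso_hom
    · left
      refine eq_zero_of_shift (c := ℓ x - ℓ y) (by lia) ?_ f
      by_cases hxy' : x ≤ y
      · have := hℓ (lt_of_le_of_ne hxy' hxy)
        exact ExtVanish.of_neg _ _ (by lia)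
      · exact H.extVanish_standard hxy' _
  generates T _ _ hT X :=
    H.generates_of_standard T (fun y => (T.prop_shift_iff_of_isStableUnderShift _ _).1 (hT y)) X

lemma shiftedCostandard_leftOrthogonal_iff (Z : Set ℤ) (X : Bounded C) :
    (shiftsOf (H.shiftedCostandard ℓ) Z).leftOrthogonal X ↔
      ∀ (y : W) (n : ℤ), ℓ y + n ∈ Z → ∀ f : Ext X (H.A y) n, f = 0 := by
  let e (y : W) (n : ℤ) : (H.shiftedCostandard ℓ y)⟦ℓ y + n⟧ ≅ (single (H.A y))⟦n⟧ :=
    (shiftFunctorAdd' (Bounded C) (-ℓ y) (ℓ y + n) n (by simp)).symm.app (single (H.A y))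
  rw [shiftsOf_leftOrthogonal_iff]
  refine ⟨fun h y n hn f => ?_, fun h y n hn f => ?_⟩
  · rw [← cancel_mono (e y n).inv, zero_comp]
    exact h y _ hn _
  · obtain ⟨m, rfl⟩ : ∃ m, n = ℓ y + m := ⟨n - ℓ y, by simp⟩
    rw [← cancel_mono (e y m).hom, zero_comp]
    exact h y m hn _

lemma isDualFamily [Finite W] :
    IsDualFamily (H.shiftedStandard ℓ) (H.shiftedCostandard ℓ) where
  hom_eq_zero x y n hn f := by
    let e : (H.shiftedCostandard ℓ y)⟦n⟧ ≅ (single (H.A y))⟦-ℓ y + n⟧ :=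
      (shiftFunctorAdd' (Bounded C) (-ℓ y) n _ rfl).symm.app (single (H.A y))
    rw [← cancel_mono e.hom, zero_comp]
    refine eq_zero_of_shift (c := ℓ x - ℓ y + n) (by lia) ?_ (f ≫ e.hom)
    refine H.extVanish_costandard ?_
    rintro rfl
    simpa using hn
  isZero X hX := by
    have hX' := (H.shiftedCostandard_leftOrthogonal_iff Set.univ X).1
      (shiftsOf_leftOrthogonal_iff.2 fun y n _ => hX y n)
    -- The objects receiving no nonzero map from any shift of `X` form a triangulated subcategory
    -- containing every `A y`, hence `X` itself; so the identity of `X` is zero.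
    let P : ObjectProperty (Bounded C) := fun Y => ∃ a : ℤ, Nonempty (Y ≅ X⟦a⟧)
    have : P.IsStableUnderShift ℤ := ⟨fun a => ⟨by
      rintro Y ⟨b, ⟨e⟩⟩
      exact ⟨b + a, ⟨(shiftFunctor _ a).mapIso e ≪≫
        (shiftFunctorAdd' (Bounded C) b a _ rfl).symm.app X⟩⟩⟩⟩
    have h : P.rightOrthogonal X := by
      refine H.generates_of_costandard P.rightOrthogonal (fun y => ?_) X
      rintro Y f ⟨a, ⟨e⟩⟩
      let e' := (shiftFunctorZero (Bounded C) ℤ).app (single (H.A y))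
      rw [← cancel_epi e.inv, ← cancel_mono e'.inv, comp_zero, zero_comp]
      exact eq_zero_of_shift (c := -a) (by simp) (hX' y (-a) trivial) _
    rw [IsZero.iff_id_eq_zero]
    exact h _ ⟨0, ⟨(shiftFunctorZero (Bounded C) ℤ).symm.app X⟩⟩

end HighestWeightCategory

end HighestWeight

theorem mainTheorem9 {k : Type*} [Field k] {C : Type u} [Category.{v} C] [Abelian C]
    [Linear k C] [HasDerivedCategory.{w} C] {W : Type*} [PartialOrder W] [Finite W]
    (H : HighestWeight.HighestWeightCategory k C W) (ℓ : W → ℤ) (hℓ : StrictMono ℓ) :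
    (∃ t : TStructure (DerivedCategory.Bounded C), t.ge 0 = HighestWeight.IsCoconnective H ℓ) ∧
    ∀ t : TStructure (DerivedCategory.Bounded C), t.ge 0 = HighestWeight.IsCoconnective H ℓ →
      t.le (-1) = HighestWeight.IsConnective H ℓ ∧
      (∀ M : DerivedCategory.Bounded C, HighestWeight.IsConnective H ℓ M ↔
        ∀ (y : W) (n : ℤ), n ≤ -ℓ y → ∀ f : HighestWeight.Ext M (H.A y) n, f = 0) ∧
      (∀ M : DerivedCategory.Bounded C, t.heart M ↔
        ∀ (y : W) (n : ℤ), n ≠ -ℓ y → ∀ f : HighestWeight.Ext M (H.A y) n, f = 0) := by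
  have h₁ : HighestWeight.IsCoconnective H ℓ =
      (HighestWeight.shiftsOf (H.shiftedCostandard ℓ) (Set.Ioi 0)).leftOrthogonal := by
    ext X
    rw [H.shiftedCostandard_leftOrthogonal_iff]
    simp only [Set.mem_Ioi, ← neg_lt_iff_pos_add']
    rfl
  have h₂ : HighestWeight.IsConnective H ℓ =
      (HighestWeight.IsCoconnective H ℓ).leftOrthogonal := by
    ext M
    exact ⟨fun h N f hN => h N hN f, fun h N hN f => h f hN⟩
  rw [h₂, h₁]
  obtain ⟨h, h'⟩ := (H.isSimpleMinded hℓ).tStructure_characterization H.isDualFamily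
  refine ⟨h, fun t ht => ⟨(h' t ht).1, fun M => ?_, fun M => ?_⟩⟩
  · rw [(h' t ht).2.1, H.shiftedCostandard_leftOrthogonal_iff]
    simp only [Set.mem_Iic, ← le_neg_iff_add_nonpos_left]
  · rw [(h' t ht).2.2, H.shiftedCostandard_leftOrthogonal_iff]
    have key (y : W) (n : ℤ) : ℓ y + n ∈ ({0}ᶜ : Set ℤ) ↔ n ≠ -ℓ y := by
      rw [Set.mem_compl_singleton_iff]
      lia
    simp only [key]
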